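/- An inverse semigroup is a semigroup in which every $s$ has a unique $s^\dagger$ with $ss^\dagger s=s$ and $s^\dagger ss^\dagger=s^\dagger$. Its natural partial order is: $s\le t$ iff $s=te$ for some idempotent $e$. $\mathcal E(\mathcal S)$ denotes the set of idempotents of $\mathcal S$. A Boolean inverse monoid is an inverse monoid $\mathcal S$ with $0$ such that $(\mathcal E(\mathcal S),\le)$ is a Boolean algebra, $(\mathcal S,\le)$ is a meet semilattice, and any $s,t$ with $s^\dagger t=ts^\dagger=0$ have a join in $\mathcal S$. Let $\mathcal S$ be a Boolean inverse monoid. Let $\widehat{\mathcal E(\mathcal S)}$ be the Stone space of the Boolean algebra $\mathcal E(\mathcal S)$ (its unital lattice homomorphisms into $\{0,1\}$), let $\mathcal D=C(\widehat{\mathcal E(\mathcal S)})$, and let $\mathcal P$ be the inverse semigroup of partial isometries of $\mathcal D$. Let $\mathcal P\overset{\iota}{\hookrightarrow}\mathcal G\overset{q}{\to}\mathcal S$ be an (idempotent separating) extension: $\mathcal G$ is an inverse semigroup, $\iota$ is an injective and $q$ a surjective semigroup homomorphism, $q(g)\in\mathcal E(\mathcal S)$ if and only if $g\in\iota(\mathcal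 P)$, and $q\circ\iota$ restricts to an isomorphism of $\mathcal E(\mathcal P)$ onto $\mathcal E(\mathcal S)$. Identify $\mathcal P$ with $\iota(\mathcal P)$. Fix an order preserving section $j:\mathcal S\to\mathcal G$ of $q$, that is, $q\circ j=\mathrm{id}$, $j(1)=1$, and $j(s)\le j(t)$ whenever $s\le t$. (Such a $j$ exists whenever $\mathcal E(\mathcal S)$ is a complete Boolean algebra.) For $s,t\in\mathcal S$ put $K(t,s)=j(s^\dagger t\wedge 1)\in\mathcal P\subseteq\mathcal D$ and $k_s(t)=K(t,s)$. Then $K$ is a positive $\mathcal D$-valued kernel, i.e. $\sum_{i,l}\overline{c_i}c_l K(s_i,s_l)\ge 0$ for all finite families $c_i\in\mathbb C$, $s_i\in\mathcal S$. Let $\mathfrak A$ be the completion of $\operatorname{span}_{\mathbb C}\{k_s:s\in\mathcal S\}$ in the norm $\|u\|=\|\langle u,u\rangle\|^{1/2}$ of the $\mathcal D$-valued inner product (conjugate linear in the first variable) with $\langle k_s,k_t\rangle=K(s,t)$. It is a right Hilbert $\mathcal D$-module of functions $\mathcal S\to\mathcal D$ with action $(uh)(s)=u(s)h$ and $u(s)=\langle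 k_s,u\rangle$. Equivalently, $\mathfrak A$ is the completion of the $\mathcal D$-linear span of the $k_s$, and $\operatorname{span}_{\mathbb C}\{k_s\}$ is dense in it. Let $\mathcal L(\mathfrak A)$ be the algebra of adjointable operators on $\mathfrak A$. For $v\in\mathcal G$ and $s\in\mathcal S$ put $\sigma(v,s)=j(q(v)s)^\dagger\,v\,j(s)$, which lies in $\mathcal P\subseteq\mathcal D$. **Theorem.** For every $v\in\mathcal G$ there is a unique bounded linear operator $\lambda(v)$ on $\mathfrak A$ such that $$\lambda(v)k_s=k_{q(v)s}\,\sigma(v,s)\qquad(s\in\mathcal S).$$ The operator $\lambda(v)$ belongs to $\mathcal L(\mathfrak A)$ and is a partial isometry, i.e. $\lambda(v)\lambda(v)^*\lambda(v)=\lambda(v)$. Moreover $\lambda:\mathcal G\to\mathcal L(\mathfrak A)$ is a one-to-one representation of $\mathcal G$: $\lambda(vw)=\lambda(v)\lambda(w)$ and $\lambda(v^\dagger)=\lambda(v)^*$ for all $v,w\in\mathcal G$, and $\lambda$ is injective. -/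

import Mathlib

open scoped ComplexOrder

universe u v

/-- An inverse semigroup: every `s` has a unique `dag s` with
`s (dag s) s = s` and `(dag s) s (dag s) = dag s`. -/
class InverseSemigroup (S : Type u) extends Semigroup S where
  dag : S → S
  mul_dag_mul : ∀ s : S, s * dag s * s = s
  dag_mul_dag : ∀ s : S, dag s * s * dag s = dag s
  dag_unique : ∀ s t : S, s * t * s = s → t * s * t = t → t = dag s

namespace InverseSemigroup

/-- The set of idempotents of a semigroup, as a type. -/
structure Idem (S : Type u) [Mul S] where
  val : S
  isIdem : IsIdempotentElem val

/-- The natural partial order: `s ≤ t` iff `s = t e` for some idempotent `e`. -/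
def NatLE {S : Type u} [Mul S] (s t : S) : Prop :=
  ∃ e : S, IsIdempotentElem e ∧ s = t * e

section basic

variable {S : Type u} [InverseSemigroup S]

lemma dag_dag (s : S) : dag (dag s) = s :=
  (dag_unique (dag s) s (dag_mul_dag s) (mul_dag_mul s)).symm

lemma dag_idem {e : S} (he : IsIdempotentElem e) : dag e = e :=
  (dag_unique e e (by rw [he.eq, he.eq]) (by rw [he.eq, he.eq])).symm

lemma isIdem_dag_mul (s : S) : IsIdempotentElem (dag s * s) := by
  unfold IsIdempotentElem
  rw [← mul_assoc, dag_mul_dag]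

lemma isIdem_mul_dag (s : S) : IsIdempotentElem (s * dag s) := by
  unfold IsIdempotentElem
  rw [← mul_assoc, mul_dag_mul]

lemma isIdem_mul {e f : S} (he : IsIdempotentElem e) (hf : IsIdempotentElem f) :
    IsIdempotentElem (e * f) := by
  have he2 : ∀ z, e * (e * z) = e * z := fun z => by rw [← mul_assoc, he.eq]
  have hf2 : ∀ z, f * (f * z) = f * z := fun z => by rw [← mul_assoc, hf.eq]
  obtain ⟨x, hx⟩ : ∃ x, x = dag (e * f) := ⟨_, rfl⟩
  have h1 : e * f * x * (e * f) = e * f := by rw [hx]; exact mul_dag_mul _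
  have h2 : x * (e * f) * x = x := by rw [hx]; exact dag_mul_dag _
  have h2a : ∀ z, x * (e * (f * (x * z))) = x * z := fun z => by
    have := congrArg (· * z) h2
    simpa only [mul_assoc] using this
  have h3 : f * x * e = x := by
    rw [hx]
    refine dag_unique (e * f) _ ?_ ?_
    · rw [← hx]
      simp only [mul_assoc] at h1 ⊢
      rw [hf2, he2, h1]
    · rw [← hx]
      simp only [mul_assoc]
      rw [he2, hf2, h2a]
  have h4 : x * x = x := by
    calc x * x = (f * x * e) * (f * x * e) := by rw [h3]
      _ = f * (x * (e * (f * (x * e)))) := by simp only [mul_assoc]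
      _ = f * x * e := by rw [h2a, mul_assoc]
      _ = x := h3
  have h5 : e * f = dag x := dag_unique x _ h2 h1
  have h6 : e * f = x := by rw [h5, dag_idem h4]
  rw [h6]
  exact h4

lemma idem_comm {e f : S} (he : IsIdempotentElem e) (hf : IsIdempotentElem f) :
    e * f = f * e := by
  have he2 : ∀ z, e * (e * z) = e * z := fun z => by rw [← mul_assoc, he.eq]
  have hf2 : ∀ z, f * (f * z) = f * z := fun z => by rw [← mul_assoc, hf.eq]
  have hef := isIdem_mul he hf
  have hfe := isIdem_mul hf he
  have : f * e = dag (e * f) := by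
    refine dag_unique _ _ ?_ ?_
    · have := hef.eq
      simp only [mul_assoc] at this ⊢
      rw [hf2, he2, this]
    · have := hfe.eq
      simp only [mul_assoc] at this ⊢
      rw [he2, hf2, this]
  rw [this, dag_idem hef]

lemma dag_mul (a b : S) : dag (a * b) = dag b * dag a := by
  have h : ∀ c d z : S, c * (dag c * (d * (dag d * z))) = d * (dag d * (c * (dag c * z))) := by
    intro c d z
    have := congrArg (· * z) (idem_comm (isIdem_mul_dag c) (isIdem_mul_dag d))
    simpa only [mul_assoc] using this
  have ha : ∀ c z : S, c * (dag c * (c * z)) = c * z := fun c z => by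
    have := congrArg (· * z) (mul_dag_mul c)
    simpa only [mul_assoc] using this
  have hc : (dag a * a) * (b * dag b) = (b * dag b) * (dag a * a) :=
    idem_comm (isIdem_dag_mul a) (isIdem_mul_dag b)
  refine (dag_unique _ _ ?_ ?_).symm
  · calc a * b * (dag b * dag a) * (a * b) = a * ((b * dag b) * (dag a * a)) * b := by
          simp only [mul_assoc]
      _ = (a * dag a * a) * (b * dag b * b) := by rw [← hc]; simp only [mul_assoc]
      _ = a * b := by rw [mul_dag_mul, mul_dag_mul]
  · calc dag b * dag a * (a * b) * (dag b * dag a)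
          = dag b * ((dag a * a) * (b * dag b)) * dag a := by simp only [mul_assoc]
      _ = (dag b * b * dag b) * (dag a * a * dag a) := by rw [hc]; simp only [mul_assoc]
      _ = dag b * dag a := by rw [dag_mul_dag, dag_mul_dag]

lemma isIdem_conj {e : S} (he : IsIdempotentElem e) (r : S) :
    IsIdempotentElem (dag r * e * r) := by
  have hc : (r * dag r) * e = e * (r * dag r) := idem_comm (isIdem_mul_dag r) he
  unfold IsIdempotentElem
  calc dag r * e * r * (dag r * e * r) = dag r * e * ((r * dag r) * e) * r := by
        simp only [mul_assoc]
    _ = dag r * (e * e) * (r * dag r * r) := by rw [hc]; simp only [mul_assoc]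
    _ = dag r * e * r := by rw [he.eq, mul_dag_mul]

lemma natLE_mul_left {s t : S} (h : NatLE s t) (r : S) : NatLE (r * s) (r * t) := by
  obtain ⟨e, he, rfl⟩ := h
  exact ⟨e, he, by rw [mul_assoc]⟩

lemma natLE_mul_right {s t : S} (h : NatLE s t) (r : S) : NatLE (s * r) (t * r) := by
  obtain ⟨e, he, rfl⟩ := h
  refine ⟨dag r * e * r, isIdem_conj he r, ?_⟩
  have hc : (r * dag r) * e = e * (r * dag r) := idem_comm (isIdem_mul_dag r) he
  calc t * e * r = t * e * (r * dag r * r) := by rw [mul_dag_mul]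
    _ = t * (e * (r * dag r)) * r := by simp only [mul_assoc]
    _ = t * r * (dag r * e * r) := by rw [← hc]; simp only [mul_assoc]

lemma natLE_dag {s t : S} (h : NatLE s t) : NatLE (dag s) (dag t) := by
  obtain ⟨e, he, rfl⟩ := h
  rw [dag_mul, dag_idem he]
  refine ⟨t * e * dag t, ?_, ?_⟩
  · have := isIdem_conj he (dag t)
    rwa [dag_dag] at this
  · have hc : (dag t * t) * e = e * (dag t * t) := idem_comm (isIdem_dag_mul t) he
    calc e * dag t = e * (dag t * t * dag t) := by rw [dag_mul_dag]
      _ = (e * (dag t * t)) * dag t := by simp only [mul_assoc]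
      _ = dag t * (t * e * dag t) := by rw [← hc]; simp only [mul_assoc]

end basic

end InverseSemigroup

open InverseSemigroup

/-- A Boolean inverse monoid: an inverse monoid with `0` whose idempotents form a Boolean algebra
in the natural partial order, which is a meet semilattice in that order, and in which any two
orthogonal elements have a join. The partial order, the meet and the Boolean algebra structure
are determined by the multiplication. -/
class BooleanInverseMonoid (S : Type u)
    extends InverseSemigroup S, MonoidWithZero S, SemilatticeInf S where
  le_iff_natLE : ∀ s t : S, s ≤ t ↔ NatLE s t
  idemBoolean : BooleanAlgebra (Idem S)
  idem_le_iff : ∀ e f : Idem S, e ≤ f ↔ e.val ≤ f.val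
  exists_join : ∀ s t : S, dag s * t = 0 → t * dag s = 0 → ∃ x : S, IsLUB {s, t} x

namespace BooleanInverseMonoid

attribute [reducible, instance] BooleanInverseMonoid.idemBoolean

variable {S : Type u} [BooleanInverseMonoid S]

lemma isIdem_of_le_one {s : S} (h : s ≤ 1) : IsIdempotentElem s := by
  obtain ⟨e, he, rfl⟩ := (le_iff_natLE _ _).1 h
  rwa [one_mul]

lemma mul_le_mul_of_le {a b c d : S} (h : a ≤ b) (h2 : c ≤ d) : a * c ≤ b * d :=
  ((le_iff_natLE _ _).2 (natLE_mul_right ((le_iff_natLE _ _).1 h) c)).trans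
    ((le_iff_natLE _ _).2 (natLE_mul_left ((le_iff_natLE _ _).1 h2) b))

lemma le_one_of_idem {e : S} (he : IsIdempotentElem e) : e ≤ 1 :=
  (le_iff_natLE _ _).2 ⟨e, he, (one_mul e).symm⟩

/-- The fixed point idempotent `s† t ∧ 1` is symmetric in `s` and `t`. -/
lemma fix_symm (s t : S) : dag s * t ⊓ 1 = dag t * s ⊓ 1 := by
  have key : ∀ a b : S, dag a * b ⊓ 1 ≤ dag b * a ⊓ 1 := by
    intro a b
    have h1 : IsIdempotentElem (dag a * b ⊓ 1) := isIdem_of_le_one inf_le_right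
    refine le_inf ?_ inf_le_right
    have h2 := natLE_dag ((le_iff_natLE _ _).1 (inf_le_left : dag a * b ⊓ 1 ≤ dag a * b))
    rw [dag_idem h1, dag_mul, dag_dag] at h2
    exact (le_iff_natLE _ _).2 h2
  exact le_antisymm (key s t) (key t s)

/-- Transitivity of the fixed point idempotents. -/
lemma fix_trans (r s t : S) : (dag r * s ⊓ 1) * (dag s * t ⊓ 1) ≤ dag r * t ⊓ 1 := by
  refine le_inf ?_ ?_
  · refine (mul_le_mul_of_le inf_le_left inf_le_left).trans ?_
    calc dag r * s * (dag s * t) = dag r * (s * dag s) * t := by simp only [mul_assoc]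
      _ ≤ dag r * 1 * t :=
        mul_le_mul_of_le (mul_le_mul_of_le le_rfl (le_one_of_idem (isIdem_mul_dag s))) le_rfl
      _ = dag r * t := by rw [mul_one]
  · calc _ ≤ (1 : S) * 1 := mul_le_mul_of_le inf_le_right inf_le_right
      _ = 1 := one_mul 1

end BooleanInverseMonoid

/-- The character space of a Boolean algebra: its (unital) lattice homomorphisms into the
two-element lattice. -/
structure CharacterSpace (L : Type u) [BooleanAlgebra L] where
  hom : BoundedLatticeHom L Bool

namespace CharacterSpace

variable {L : Type u} [BooleanAlgebra L]

/-- The set `G_e` of the characters supported on `e`. -/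
def basic (e : L) : Set (CharacterSpace L) := {ρ | ρ.hom e = true}

/-- The Stone topology, generated by the sets `G_e`. -/
instance : TopologicalSpace (CharacterSpace L) :=
  TopologicalSpace.generateFrom (Set.range (basic (L := L)))

lemma isInducing_hom :
    Topology.IsInducing (fun (ρ : CharacterSpace L) (e : L) => ρ.hom e) := by
  refine ⟨le_antisymm ?_ ?_⟩
  · rw [← continuous_iff_le_induced]
    refine continuous_pi fun e => ?_
    rw [continuous_discrete_rng]
    have h : ∀ e : L, IsOpen (basic e) := fun e =>
      TopologicalSpace.isOpen_generateFrom_of_mem ⟨e, rfl⟩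
    intro b
    cases b with
    | true => exact h e
    | false =>
      have : ((fun ρ : CharacterSpace L => ρ.hom e) ⁻¹' {false}) = basic eᶜ := by
        ext ρ
        have h1 : ρ.hom eᶜ = (ρ.hom e)ᶜ := map_compl' _ _
        change ρ.hom e = false ↔ ρ.hom eᶜ = true
        rw [h1]
        cases ρ.hom e <;> decide
      rw [this]
      exact h _
  · refine le_generateFrom ?_
    rintro _ ⟨e, rfl⟩
    refine ⟨{f : L → Bool | f e = true}, ?_, rfl⟩
    exact (isOpen_discrete ({true} : Set Bool)).preimage
      (continuous_apply (A := fun _ : L => Bool) e)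

instance : CompactSpace (CharacterSpace L) := by
  have hcl : IsClosed (Set.range (fun (ρ : CharacterSpace L) (e : L) => ρ.hom e)) := by
    have : Set.range (fun (ρ : CharacterSpace L) (e : L) => ρ.hom e) =
        {f | f ⊤ = ⊤} ∩ {f | f ⊥ = ⊥} ∩ (⋂ a, ⋂ b, {f | f (a ⊔ b) = f a ⊔ f b}) ∩
          (⋂ a, ⋂ b, {f | f (a ⊓ b) = f a ⊓ f b}) := by
      ext f
      constructor
      · rintro ⟨ρ, rfl⟩
        refine ⟨⟨⟨map_top ρ.hom, map_bot ρ.hom⟩, ?_⟩, ?_⟩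
        · exact Set.mem_iInter₂.2 fun a b => map_sup ρ.hom a b
        · exact Set.mem_iInter₂.2 fun a b => map_inf ρ.hom a b
      · rintro ⟨⟨⟨h1, h2⟩, h3⟩, h4⟩
        exact ⟨⟨⟨⟨⟨f, fun a b => Set.mem_iInter₂.1 h3 a b⟩,
          fun a b => Set.mem_iInter₂.1 h4 a b⟩, h1, h2⟩⟩, rfl⟩
    rw [this]
    have hc : ∀ a : L, Continuous fun f : L → Bool => f a := fun a => continuous_apply a
    have h2 : ∀ (g : Bool × Bool → Bool) (a b : L),
        Continuous fun f : L → Bool => g (f a, f b) := fun g a b =>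
      (continuous_of_discreteTopology (f := g)).comp ((hc a).prodMk (hc b))
    refine IsClosed.inter (IsClosed.inter (IsClosed.inter ?_ ?_) ?_) ?_
    · exact isClosed_eq (hc _) continuous_const
    · exact isClosed_eq (hc _) continuous_const
    · exact isClosed_iInter fun a => isClosed_iInter fun b =>
        isClosed_eq (hc _) (h2 (fun p => p.1 ⊔ p.2) a b)
    · exact isClosed_iInter fun a => isClosed_iInter fun b =>
        isClosed_eq (hc _) (h2 (fun p => p.1 ⊓ p.2) a b)
  rw [← isCompact_univ_iff, isInducing_hom.isCompact_iff, Set.image_univ]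
  exact hcl.isCompact

end CharacterSpace

/-- The C⋆-algebra `D = C(X)` of a Boolean inverse monoid, `X` the character space of its
Boolean algebra of idempotents. -/
abbrev DAlg (S : Type u) [BooleanInverseMonoid S] : Type u := C(CharacterSpace (Idem S), ℂ)

/-- The semigroup of partial isometries of a commutative star ring. -/
def partialIsometries (A : Type u) [CommSemiring A] [StarRing A] : Subsemigroup A where
  carrier := {p | p * star p * p = p}
  mul_mem' := by
    intro a b ha hb
    change _ = _ at ha hb
    change _ = _
    calc a * b * star (a * b) * (a * b) = (a * star a * a) * (b * star b * b) := by
          rw [star_mul]; ring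
      _ = a * b := by rw [ha, hb]

/-- An (idempotent separating) extension `P ↪ G → S` of the inverse semigroup `S` by `P`, where
`π = q ∘ ι : P → S` takes values in the idempotents of `S` and restricts to an isomorphism of the
idempotents of `P` onto the idempotents of `S`. -/
structure InvExtension (P : Type*) (G : Type*) (S : Type*) [Semigroup P] [InverseSemigroup G]
    [InverseSemigroup S] where
  ι : P →ₙ* G
  q : G →ₙ* S
  ι_injective : Function.Injective ι
  q_surjective : Function.Surjective q
  isIdem_q_iff : ∀ g : G, IsIdempotentElem (q g) ↔ ∃ p : P, ι p = g
  bijOn_idem : Set.BijOn (fun p => q (ι p)) {p | IsIdempotentElem p} {e | IsIdempotentElem e}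

/-- An extension of a Boolean inverse monoid `S` by the partial isometries of `D`. -/
abbrev BooleanExtension (S : Type u) [BooleanInverseMonoid S] (G : Type v) [InverseSemigroup G] :=
  InvExtension (partialIsometries (DAlg S)) G S

/-- An order preserving section `j` of the quotient map `q`; the middle condition is `j(1) = 1`,
stated as: `j(1)` is an identity element of `G`. -/
structure OrderPreservingSection {S : Type u} [BooleanInverseMonoid S] {G : Type v}
    [InverseSemigroup G] (X : BooleanExtension S G) where
  j : S → G
  q_j : ∀ s, X.q (j s) = s
  j_one : ∀ g : G, j 1 * g = g ∧ g * j 1 = g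
  j_mono : ∀ s t : S, s ≤ t → NatLE (j s) (j t)

/-- An element of `G` lying over an idempotent of `S`, regarded as a partial isometry of `D`
through the inclusion `ι`. -/
noncomputable def InvExtension.pull {P G S : Type*} [Semigroup P] [InverseSemigroup G]
    [InverseSemigroup S] (X : InvExtension P G S) (g : G) (hg : IsIdempotentElem (X.q g)) : P :=
  ((X.isIdem_q_iff g).1 hg).choose

lemma InvExtension.ι_pull {P G S : Type*} [Semigroup P] [InverseSemigroup G]
    [InverseSemigroup S] (X : InvExtension P G S) (g : G) (hg : IsIdempotentElem (X.q g)) :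
    X.ι (X.pull g hg) = g :=
  ((X.isIdem_q_iff g).1 hg).choose_spec

lemma InvExtension.q_dag {P G S : Type*} [Semigroup P] [InverseSemigroup G]
    [InverseSemigroup S] (X : InvExtension P G S) (g : G) : X.q (dag g) = dag (X.q g) := by
  refine dag_unique _ _ ?_ ?_
  · rw [← map_mul, ← map_mul, mul_dag_mul]
  · rw [← map_mul, ← map_mul, dag_mul_dag]

/-- A positive `C(X)`-valued kernel on a set `S`. -/
structure PositiveKernel (S : Type u) (X : Type v) [TopologicalSpace X] where
  K : S → S → C(X, ℂ)
  star_K : ∀ s t, star (K s t) = K t s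
  nonneg : ∀ (n : ℕ) (c : Fin n → ℂ) (s : Fin n → S),
    0 ≤ ∑ i, ∑ l, (star (c i) * c l) • K (s i) (s l)

namespace PositiveKernel

variable {S : Type u} {X : Type v} [TopologicalSpace X]

/-- The column function `k_s(t) = K(t, s)`. -/
def col (κ : PositiveKernel S X) (s : S) : S → C(X, ℂ) := fun t => κ.K t s

/-- The `C(X)`-module of functions `S → C(X)` spanned by the columns `k_s`. The algebra is
commutative, so the right action `(u h)(s) = u(s) h` is written on the left. -/
def Pre (κ : PositiveKernel S X) : Type (max u v) :=
  Submodule.span C(X, ℂ) (Set.range κ.col)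

variable (κ : PositiveKernel S X)

noncomputable instance : AddCommGroup κ.Pre :=
  inferInstanceAs (AddCommGroup (Submodule.span C(X, ℂ) (Set.range κ.col)))

noncomputable instance : Module C(X, ℂ) κ.Pre :=
  inferInstanceAs (Module C(X, ℂ) (Submodule.span C(X, ℂ) (Set.range κ.col)))

noncomputable instance : Module ℂ κ.Pre :=
  inferInstanceAs (Module ℂ (Submodule.span C(X, ℂ) (Set.range κ.col)))

/-- The function underlying an element of the pre-module. -/
def Pre.fn {κ : PositiveKernel S X} (u : κ.Pre) : S → C(X, ℂ) := Subtype.val u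

/-- The column `k_s` as an element of the pre-module. -/
def preCol (s : S) : κ.Pre := ⟨κ.col s, Submodule.subset_span ⟨s, rfl⟩⟩

variable {κ}

lemma Pre.ext {u w : κ.Pre} (h : ∀ s, u.fn s = w.fn s) : u = w := Subtype.ext (funext h)

@[simp] lemma Pre.fn_add (u w : κ.Pre) (s : S) : (u + w).fn s = u.fn s + w.fn s := rfl
@[simp] lemma Pre.fn_smul (h : C(X, ℂ)) (u : κ.Pre) (s : S) : (h • u).fn s = h * u.fn s := rfl
@[simp] lemma Pre.fn_smulc (z : ℂ) (u : κ.Pre) (s : S) : (z • u).fn s = z • u.fn s := rfl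
@[simp] lemma Pre.fn_zero (s : S) : (0 : κ.Pre).fn s = 0 := rfl
@[simp] lemma fn_preCol (s t : S) : (κ.preCol s).fn t = κ.K t s := rfl

lemma Pre.induction {p : κ.Pre → Prop} (u : κ.Pre) (zero : p 0) (col : ∀ s, p (κ.preCol s))
    (add : ∀ a b, p a → p b → p (a + b)) (smul : ∀ (h : C(X, ℂ)) a, p a → p (h • a)) : p u :=
  Submodule.span_induction
    (p := fun f hf => p (⟨f, hf⟩ : Submodule.span C(X, ℂ) (Set.range κ.col)))
    (by rintro _ ⟨s, rfl⟩; exact col s) zero (fun _ _ _ _ h1 h2 => add _ _ h1 h2)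
    (fun c _ _ h => smul c _ h) u.2

lemma Pre.exists_rep (u : κ.Pre) :
    ∃ c : S →₀ C(X, ℂ), ∀ t, u.fn t = ∑ s ∈ c.support, c s * κ.K t s := by
  obtain ⟨c, hc⟩ := (Finsupp.mem_span_range_iff_exists_finsupp (R := C(X, ℂ))).1 u.2
  refine ⟨c, fun t => ?_⟩
  have := congrFun hc t
  change _ = u.fn t at this
  rw [← this, Finsupp.sum, Finset.sum_apply]
  rfl

/-- Coefficients `d` with `u = ∑ k_s d_s`. -/
noncomputable def Pre.rep (u : κ.Pre) : S →₀ C(X, ℂ) := u.exists_rep.choose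

lemma Pre.fn_eq (u : κ.Pre) (t : S) :
    u.fn t = ∑ s ∈ u.rep.support, u.rep s * κ.K t s := u.exists_rep.choose_spec t

/-- The inner product, conjugate linear in the first variable: for `u = ∑ k_s c_s`,
`w = ∑ k_t d_t` it is `∑ (star c_s) K(s, t) d_t` (see `Pre.ip_expand`). -/
noncomputable def Pre.ip (u w : κ.Pre) : C(X, ℂ) := ∑ s ∈ u.rep.support, star (u.rep s) * w.fn s

lemma Pre.ip_expand (u w : κ.Pre) : Pre.ip u w =
    ∑ s ∈ u.rep.support, ∑ t ∈ w.rep.support, star (u.rep s) * w.rep t * κ.K s t := by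
  rw [ip]
  refine Finset.sum_congr rfl fun s _ => ?_
  rw [w.fn_eq, Finset.mul_sum]
  simp only [mul_assoc]

lemma Pre.star_ip (u w : κ.Pre) : star (Pre.ip u w) = Pre.ip w u := by
  rw [ip_expand, ip_expand, star_sum, Finset.sum_comm]
  refine Finset.sum_congr rfl fun s _ => ?_
  rw [star_sum]
  refine Finset.sum_congr rfl fun t _ => ?_
  rw [star_mul, star_mul, star_star, κ.star_K, mul_comm]

lemma Pre.ip_preCol_left (s : S) (w : κ.Pre) : Pre.ip (κ.preCol s) w = w.fn s := by
  rw [← star_ip, ip, star_sum, w.fn_eq]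
  refine Finset.sum_congr rfl fun t _ => ?_
  rw [star_mul, star_star, fn_preCol, κ.star_K, mul_comm]

lemma Pre.ip_add_right (u w z : κ.Pre) :
    Pre.ip u (w + z) = Pre.ip u w + Pre.ip u z := by
  simp only [ip, fn_add, mul_add, Finset.sum_add_distrib]

lemma Pre.ip_smul_right (u : κ.Pre) (h : C(X, ℂ)) (w : κ.Pre) :
    Pre.ip u (h • w) = h * Pre.ip u w := by
  simp only [ip, fn_smul, Finset.mul_sum]
  refine Finset.sum_congr rfl fun t _ => ?_
  ring

lemma Pre.ip_smulc_right (u : κ.Pre) (z : ℂ) (w : κ.Pre) :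
    Pre.ip u (z • w) = z • Pre.ip u w := by
  simp only [ip, fn_smulc, Finset.smul_sum, mul_smul_comm]

lemma Pre.ip_self_nonneg (u : κ.Pre) : 0 ≤ Pre.ip u u := by
  rw [ContinuousMap.le_def]
  intro x
  have key := ContinuousMap.le_def.1 (κ.nonneg u.rep.support.card
    (fun i => u.rep (u.rep.support.equivFin.symm i) x)
    (fun i => u.rep.support.equivFin.symm i)) x
  rw [ip_expand]
  convert key using 1
  simp only [ContinuousMap.coe_sum, Finset.sum_apply, ContinuousMap.smul_apply,
    ContinuousMap.mul_apply, ContinuousMap.star_apply, smul_eq_mul]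
  rw [← Finset.sum_coe_sort, ← Equiv.sum_comp u.rep.support.equivFin.symm]
  refine Finset.sum_congr rfl fun i _ => ?_
  rw [← Finset.sum_coe_sort, ← Equiv.sum_comp u.rep.support.equivFin.symm]

/-- The scalar semi-inner product obtained by evaluating at a point of `X`. -/
@[reducible]
noncomputable def Pre.core (x : X) : PreInnerProductSpace.Core ℂ κ.Pre where
  inner u w := Pre.ip u w x
  conj_inner_symm u w := by
    rw [← star_ip w u]
    rfl
  re_inner_nonneg u :=
    (Complex.le_def.1 (ContinuousMap.le_def.1 (ip_self_nonneg u) x)).1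
  add_left u w z := by
    rw [← star_ip z, ip_add_right, star_add, star_ip, star_ip]
    rfl
  smul_left u w r := by
    rw [← star_ip w, ip_smulc_right, star_smul, star_ip]
    rfl

lemma Pre.ip_self {u : κ.Pre} : Pre.ip u u = 0 ↔ u = 0 := by
  constructor
  · intro h
    refine Pre.ext fun s => ?_
    ext x
    have key := @InnerProductSpace.Core.inner_mul_inner_self_le ℂ κ.Pre _ _ _ (Pre.core x)
      (κ.preCol s) u
    change ‖Pre.ip (κ.preCol s) u x‖ * ‖Pre.ip u (κ.preCol s) x‖ ≤
      RCLike.re (Pre.ip (κ.preCol s) (κ.preCol s) x) *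
        RCLike.re (Pre.ip u u x) at key
    rw [h, ← Pre.star_ip (κ.preCol s) u, Pre.ip_preCol_left] at key
    simp only [ContinuousMap.star_apply, norm_star, ContinuousMap.zero_apply, map_zero,
      mul_zero] at key
    have h2 : ‖u.fn s x‖ = 0 := by nlinarith [norm_nonneg (u.fn s x)]
    simpa using h2
  · rintro rfl
    simp [ip]

variable [CompactSpace X]

noncomputable instance : Norm κ.Pre where
  norm u := √‖Pre.ip u u‖

noncomputable instance : CStarModule C(X, ℂ) κ.Pre where
  inner := Pre.ip
  inner_add_right := Pre.ip_add_right _ _ _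
  inner_self_nonneg := Pre.ip_self_nonneg _
  inner_self := Pre.ip_self
  inner_op_smul_right := Pre.ip_smul_right _ _ _
  inner_smul_right_complex := Pre.ip_smulc_right _ _ _
  star_inner := Pre.star_ip
  norm_eq_sqrt_norm_inner_self _ := rfl

noncomputable instance : NormedAddCommGroup κ.Pre := CStarModule.normedAddCommGroup C(X, ℂ)

noncomputable instance : NormedSpace ℂ κ.Pre := .ofCore (CStarModule.normedSpaceCore C(X, ℂ))

instance : IsBoundedSMul C(X, ℂ) κ.Pre := by
  refine .of_norm_smul_le fun h u => ?_
  refine le_of_sq_le_sq ?_ (by positivity)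
  rw [mul_pow, CStarModule.norm_sq_eq (E := κ.Pre) C(X, ℂ),
    CStarModule.norm_sq_eq (E := κ.Pre) C(X, ℂ)]
  rw [CStarModule.inner_op_smul_left, CStarModule.inner_op_smul_right]
  refine (norm_mul_le _ _).trans ?_
  rw [norm_star]
  have := norm_mul_le h (inner C(X, ℂ) u u)
  nlinarith [norm_nonneg h]

variable (κ)

/-- The reproducing kernel Hilbert module of `κ`: the completion of the `C(X)`-span of the columns
in the norm `‖u‖ = ‖⟨u, u⟩‖ ^ (1 / 2)`. Whenever the complex span of the columns is dense in it, it
is also the completion of that complex span. -/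
noncomputable def RKModule : Type (max u v) := UniformSpace.Completion κ.Pre

noncomputable instance : NormedAddCommGroup κ.RKModule :=
  inferInstanceAs (NormedAddCommGroup (UniformSpace.Completion κ.Pre))

noncomputable instance : NormedSpace ℂ κ.RKModule :=
  inferInstanceAs (NormedSpace ℂ (UniformSpace.Completion κ.Pre))

instance : CompleteSpace κ.RKModule :=
  inferInstanceAs (CompleteSpace (UniformSpace.Completion κ.Pre))

noncomputable instance : Module C(X, ℂ) κ.RKModule :=
  inferInstanceAs (Module C(X, ℂ) (UniformSpace.Completion κ.Pre))

variable {κ}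

/-- The canonical dense embedding of the pre-module. -/
noncomputable def toRK (u : κ.Pre) : κ.RKModule := (u : UniformSpace.Completion κ.Pre)

/-- The inner product of the completion, extended by continuity. -/
noncomputable def rkip (u w : κ.RKModule) : C(X, ℂ) :=
  Inner.inner (𝕜 := C(X, ℂ)) (E := UniformSpace.Completion κ.Pre) u w

lemma continuous_preInner :
    Continuous (Function.uncurry (inner C(X, ℂ) (E := κ.Pre))) :=
  CStarModule.continuous_inner

lemma rkip_toRK (u w : κ.Pre) :
    rkip (toRK u) (toRK w) = Pre.ip u w :=
  (UniformSpace.Completion.isDenseInducing_coe.prodMap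
    UniformSpace.Completion.isDenseInducing_coe).extend_eq continuous_preInner (u, w)

lemma continuous_rkInner :
    Continuous (fun p : κ.RKModule × κ.RKModule => rkip p.1 p.2) := by
  let B : κ.Pre →+ κ.Pre →+ C(X, ℂ) :=
    { toFun := fun u => (CStarModule.innerₛₗ (A := C(X, ℂ)) u).toAddMonoidHom
      map_zero' := by ext w; simp
      map_add' := fun u w => by ext z; simp }
  have hB : Continuous fun p : κ.Pre × κ.Pre => B p.1 p.2 := continuous_preInner
  exact (UniformSpace.Completion.isDenseInducing_toCompl κ.Pre).extend_Z_bilin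
    (UniformSpace.Completion.isDenseInducing_toCompl κ.Pre) hB

lemma denseRange_toRK : DenseRange (toRK (κ := κ)) := UniformSpace.Completion.denseRange_coe

instance : ContinuousConstSMul C(X, ℂ) κ.RKModule :=
  inferInstanceAs (ContinuousConstSMul C(X, ℂ) (UniformSpace.Completion κ.Pre))

lemma toRK_add (u w : κ.Pre) : toRK u + toRK w = toRK (u + w) :=
  (UniformSpace.Completion.coe_add u w).symm

lemma toRK_smul (h : C(X, ℂ)) (u : κ.Pre) : h • toRK u = toRK (h • u) :=
  (UniformSpace.Completion.coe_smul h u).symm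

lemma toRK_smulc (z : ℂ) (u : κ.Pre) : z • toRK u = toRK (z • u) :=
  (UniformSpace.Completion.coe_smul z u).symm

lemma norm_toRK (u : κ.Pre) : ‖toRK u‖ = ‖u‖ := UniformSpace.Completion.norm_coe u

lemma rk_norm_eq (u : κ.RKModule) : ‖u‖ = √‖rkip u u‖ := by
  refine denseRange_toRK.induction_on u ?_ fun u => ?_
  · exact isClosed_eq continuous_norm
      (continuous_norm.comp (continuous_rkInner.comp (continuous_id.prodMk continuous_id))).sqrt
  · rw [norm_toRK, rkip_toRK]
    rfl

noncomputable instance : CStarModule C(X, ℂ) κ.RKModule where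
  inner := rkip
  inner_add_right {u w z} := by
    have h := continuous_rkInner (κ := κ)
    refine denseRange_toRK.induction_on₃ (p := fun u w z : κ.RKModule =>
      rkip u (w + z) = rkip u w + rkip u z) ?_ ?_ u w z
    · exact isClosed_eq
        (h.comp (continuous_fst.prodMk (continuous_snd.fst.add continuous_snd.snd)))
        ((h.comp (continuous_fst.prodMk continuous_snd.fst)).add
          (h.comp (continuous_fst.prodMk continuous_snd.snd)))
    · intro u w z
      rw [toRK_add, rkip_toRK, rkip_toRK, rkip_toRK, Pre.ip_add_right]
  inner_self_nonneg {u} := by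
    rw [ContinuousMap.le_def]
    intro x
    have h := continuous_rkInner (κ := κ)
    refine denseRange_toRK.induction_on (p := fun u : κ.RKModule =>
      (0 : ℂ) ≤ rkip u u x) u ?_ fun u => ?_
    · exact isClosed_le continuous_const
        ((continuous_eval_const x).comp (h.comp (continuous_id.prodMk continuous_id)))
    · rw [rkip_toRK]
      exact ContinuousMap.le_def.1 (Pre.ip_self_nonneg u) x
  inner_self {u} := by
    rw [← norm_eq_zero (a := u), rk_norm_eq, Real.sqrt_eq_zero (norm_nonneg _), norm_eq_zero]
  inner_op_smul_right {a u w} := by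
    have h := continuous_rkInner (κ := κ)
    refine denseRange_toRK.induction_on₂ (p := fun u w : κ.RKModule =>
      rkip u (a • w) = a * rkip u w) ?_ ?_ u w
    · exact isClosed_eq (h.comp (continuous_fst.prodMk (continuous_snd.const_smul a)))
        (continuous_const.mul h)
    · intro u w
      rw [toRK_smul, rkip_toRK, rkip_toRK, Pre.ip_smul_right]
  inner_smul_right_complex {a u w} := by
    have h := continuous_rkInner (κ := κ)
    refine denseRange_toRK.induction_on₂ (p := fun u w : κ.RKModule =>
      rkip u (a • w) = a • rkip u w) ?_ ?_ u w
    · exact isClosed_eq (h.comp (continuous_fst.prodMk (continuous_snd.const_smul a)))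
        (h.const_smul a)
    · intro u w
      rw [toRK_smulc, rkip_toRK, rkip_toRK, Pre.ip_smulc_right]
  star_inner u w := by
    have h := continuous_rkInner (κ := κ)
    refine denseRange_toRK.induction_on₂ (p := fun u w : κ.RKModule =>
      star (rkip u w) = rkip w u) ?_ ?_ u w
    · exact isClosed_eq h.star (h.comp continuous_swap)
    · intro u w
      rw [rkip_toRK, rkip_toRK, Pre.star_ip]
  norm_eq_sqrt_norm_inner_self u := rk_norm_eq u

lemma inner_toRK (u w : κ.Pre) : inner C(X, ℂ) (toRK u) (toRK w) = Pre.ip u w := rkip_toRK u w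

lemma continuous_inner_rk :
    Continuous (fun p : κ.RKModule × κ.RKModule => inner C(X, ℂ) p.1 p.2) := continuous_rkInner

variable (κ)

/-- The column function `k_s` as an element of the module. -/
noncomputable def k (s : S) : κ.RKModule := toRK (κ.preCol s)

lemma inner_k_k (s t : S) : inner C(X, ℂ) (κ.k s) (κ.k t) = κ.K s t := by
  rw [k, k, inner_toRK, Pre.ip_preCol_left, fn_preCol]

/-- The function `S → C(X)` represented by an element of the module. -/
noncomputable def eval (u : κ.RKModule) (s : S) : C(X, ℂ) := inner C(X, ℂ) (κ.k s) u

lemma eval_toRK (u : κ.Pre) (s : S) : κ.eval (toRK u) s = u.fn s := by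
  rw [eval, k, inner_toRK, Pre.ip_preCol_left]

/-- The module is a space of functions: an element is determined by its values. -/
lemma eval_injective : Function.Injective κ.eval := by
  have key : ∀ u : κ.RKModule, (∀ s, κ.eval u s = 0) → u = 0 := by
    intro u hu
    have h : ∀ w : κ.RKModule, inner C(X, ℂ) u w = 0 := by
      intro w
      refine denseRange_toRK.induction_on (p := fun w : κ.RKModule => inner C(X, ℂ) u w = 0)
        w ?_ fun w => ?_
      · exact isClosed_eq (continuous_inner_rk.comp (continuous_const.prodMk continuous_id))
          continuous_const
      · induction w using Pre.induction with
        | zero => exact CStarModule.inner_zero_right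
        | col s =>
          have := congrArg star (hu s)
          rwa [eval, CStarModule.star_inner, star_zero] at this
        | add a b h1 h2 => rw [← toRK_add, CStarModule.inner_add_right, h1, h2, add_zero]
        | smul c a h1 => rw [← toRK_smul, CStarModule.inner_op_smul_right, h1, mul_zero]
    exact CStarModule.inner_self.1 (h u)
  intro u w h
  rw [← sub_eq_zero]
  refine key _ fun s => ?_
  rw [eval, CStarModule.inner_sub_right, sub_eq_zero]
  exact congrFun h s

end PositiveKernel

namespace OrderPreservingSection

variable {S : Type u} [BooleanInverseMonoid S] {G : Type v} [InverseSemigroup G]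
  {X : BooleanExtension S G} (J : OrderPreservingSection X)

/-- For an idempotent `e` of `S`, the element `j(e)` regarded as an element of `D`. -/
noncomputable def proj (e : S) (he : IsIdempotentElem e) : DAlg S :=
  X.pull (J.j e) (by rwa [J.q_j])

lemma isIdem_j {e : S} (he : IsIdempotentElem e) : IsIdempotentElem (J.j e) := by
  obtain ⟨g, hg, h⟩ := J.j_mono e 1 (BooleanInverseMonoid.le_one_of_idem he)
  rw [h, (J.j_one g).1]
  exact hg

/-- The extension separates idempotents. -/
lemma idem_sep {g h : G} (hg : IsIdempotentElem g) (hh : IsIdempotentElem h)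
    (hq : X.q g = X.q h) : g = h := by
  have aux : ∀ {g : G}, IsIdempotentElem g → ∃ p, IsIdempotentElem p ∧ X.ι p = g := by
    intro g hg
    obtain ⟨p, rfl⟩ := (X.isIdem_q_iff g).1 (by
      have := congrArg X.q hg.eq
      rwa [map_mul] at this)
    refine ⟨p, X.ι_injective ?_, rfl⟩
    rw [map_mul]
    exact hg
  obtain ⟨p, hp, rfl⟩ := aux hg
  obtain ⟨r, hr, rfl⟩ := aux hh
  rw [X.bijOn_idem.injOn hp hr hq]

lemma proj_mul {e f : S} (he : IsIdempotentElem e) (hf : IsIdempotentElem f)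
    (hef : IsIdempotentElem (e * f)) : J.proj (e * f) hef = J.proj e he * J.proj f hf := by
  refine congrArg Subtype.val (X.ι_injective (?_ : _ = X.ι (X.pull (J.j e) _ * X.pull (J.j f) _)))
  rw [map_mul, X.ι_pull, X.ι_pull, X.ι_pull]
  refine idem_sep (X := X) (J.isIdem_j hef) (isIdem_mul (J.isIdem_j he) (J.isIdem_j hf)) ?_
  rw [map_mul, J.q_j, J.q_j, J.q_j]

lemma proj_apply {e : S} (he : IsIdempotentElem e) (x : CharacterSpace (Idem S)) :
    J.proj e he x = 0 ∨ J.proj e he x = 1 := by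
  have h : J.proj e he = J.proj e he * J.proj e he := by
    rw [← J.proj_mul he he (isIdem_mul he he)]
    congr 1
    exact he.eq.symm
  have := congrArg (fun f : DAlg S => f x) h
  simp only [ContinuousMap.mul_apply] at this
  by_cases h0 : J.proj e he x = 0
  · exact Or.inl h0
  · refine Or.inr (mul_left_cancel₀ h0 ?_)
    rw [mul_one]
    exact this.symm

/-- The kernel function `K(t, s) = j(s† t ∧ 1)`. -/
noncomputable def kernelFun (t s : S) : DAlg S :=
  J.proj (dag s * t ⊓ 1) (BooleanInverseMonoid.isIdem_of_le_one inf_le_right)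

lemma kernelFun_symm (t s : S) : J.kernelFun t s = J.kernelFun s t := by
  unfold kernelFun
  congr 1
  exact BooleanInverseMonoid.fix_symm s t

lemma kernelFun_trans (r s t : S) (x : CharacterSpace (Idem S)) (h1 : J.kernelFun r s x = 1)
    (h2 : J.kernelFun s t x = 1) : J.kernelFun r t x = 1 := by
  have hle := BooleanInverseMonoid.fix_trans t s r
  have he : IsIdempotentElem (dag t * s ⊓ 1) := BooleanInverseMonoid.isIdem_of_le_one inf_le_right
  have hf : IsIdempotentElem (dag s * r ⊓ 1) := BooleanInverseMonoid.isIdem_of_le_one inf_le_right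
  have hg : IsIdempotentElem (dag t * r ⊓ 1) := BooleanInverseMonoid.isIdem_of_le_one inf_le_right
  obtain ⟨g, hgi, hge⟩ := (BooleanInverseMonoid.le_iff_natLE _ _).1 hle
  have hef := isIdem_mul he hf
  have h3 : J.proj _ hef = J.proj _ hg * J.proj _ hef := by
    rw [← J.proj_mul hg hef (isIdem_mul hg hef)]
    congr 1
    rw [hge, ← mul_assoc, hg.eq]
  rw [J.proj_mul he hf hef] at h3
  have := congrArg (fun f : DAlg S => f x) h3
  simp only [ContinuousMap.mul_apply] at this
  change J.kernelFun s t x * J.kernelFun r s x =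
    J.kernelFun r t x * (J.kernelFun s t x * J.kernelFun r s x) at this
  rw [h1, h2] at this
  simpa using this.symm

/-- A partial equivalence relation defines a positive semidefinite matrix. -/
lemma per_nonneg {n : ℕ} (R : Fin n → Fin n → Prop) (hs : ∀ i l, R i l → R l i)
    (ht : ∀ i l m, R i l → R l m → R i m) (c : Fin n → ℂ) (a : Fin n → Fin n → ℂ)
    (h0 : ∀ i l, ¬ R i l → a i l = 0) (h1 : ∀ i l, R i l → a i l = 1) :
    0 ≤ ∑ i, ∑ l, star (c i) * c l * a i l := by
  classical
  let F : Fin n → Finset (Fin n) := fun i => Finset.univ.filter (R i)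
  let d : Finset (Fin n) → Fin n → ℂ := fun A i => if R i i ∧ F i = A then c i else 0
  have key : ∑ i, ∑ l, star (c i) * c l * a i l = ∑ A, star (∑ i, d A i) * ∑ l, d A l := by
    have h : ∀ i l, star (c i) * c l * a i l = ∑ A, star (d A i) * d A l := by
      intro i l
      by_cases hil : R i l
      · have hii := ht _ _ _ hil (hs _ _ hil)
        have hll := ht _ _ _ (hs _ _ hil) hil
        have hF : F l = F i := by
          ext m
          simp only [F, Finset.mem_filter, Finset.mem_univ, true_and]
          exact ⟨fun h => ht _ _ _ hil h, fun h => ht _ _ _ (hs _ _ hil) h⟩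
        rw [Finset.sum_eq_single (F i)]
        · simp [d, hii, hll, hF, h1 _ _ hil]
        · intro A _ hA
          simp [d, Ne.symm hA]
        · simp
      · rw [h0 _ _ hil, mul_zero]
        refine (Finset.sum_eq_zero fun A _ => ?_).symm
        by_cases hi : R i i ∧ F i = A
        · by_cases hl : R l l ∧ F l = A
          · exfalso
            have : l ∈ F l := by simp [F, hl.1]
            rw [hl.2, ← hi.2] at this
            exact hil (by simpa [F] using this)
          · simp [d, hl]
        · simp [d, hi]
    simp only [h, star_sum, Finset.sum_mul_sum]
    rw [Finset.sum_comm]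
    simp only [Finset.sum_comm (t := (Finset.univ : Finset (Finset (Fin n))))]
    refine Finset.sum_congr rfl fun A _ => ?_
    rw [Finset.sum_comm]
  rw [key]
  exact Finset.sum_nonneg fun A _ => star_mul_self_nonneg _

/-- The positive `D`-valued kernel `K(t, s) = j(s† t ∧ 1)` on `S`. -/
noncomputable def kernel : PositiveKernel S (CharacterSpace (Idem S)) where
  K := J.kernelFun
  star_K s t := by
    rw [J.kernelFun_symm t s]
    ext x
    rw [ContinuousMap.star_apply]
    rcases J.proj_apply (BooleanInverseMonoid.isIdem_of_le_one
      (inf_le_right : dag t * s ⊓ 1 ≤ 1)) x with h | h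
    · change J.kernelFun s t x = 0 at h
      rw [h, star_zero]
    · change J.kernelFun s t x = 1 at h
      rw [h, star_one]
  nonneg n c s := by
    rw [ContinuousMap.le_def]
    intro x
    simp only [ContinuousMap.coe_sum, Finset.sum_apply, ContinuousMap.smul_apply, smul_eq_mul]
    refine per_nonneg (fun i l => J.kernelFun (s i) (s l) x = 1) ?_ ?_ c _ ?_ fun i l h => h
    · intro i l h
      rwa [J.kernelFun_symm]
    · exact fun i l m h h2 => J.kernelFun_trans _ _ _ x h h2
    · intro i l h
      exact (J.proj_apply _ x).resolve_right h

/-- The right Hilbert `D`-module `𝔄` with reproducing kernel `K`. -/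
noncomputable abbrev hilbertModule : Type u := J.kernel.RKModule

/-- The cocycle-like function `σ(v, s) = j(q(v) s)† v j(s)`, as an element of `D`. -/
noncomputable def sigma (v : G) (s : S) : DAlg S :=
  X.pull (dag (J.j (X.q v * s)) * v * J.j s) (by
    rw [map_mul, map_mul, X.q_dag, J.q_j, J.q_j, mul_assoc]
    exact isIdem_dag_mul _)

end OrderPreservingSection

section Adjointable

variable (A E : Type*) [CStarAlgebra A] [PartialOrder A] [SMul A E] [NormedAddCommGroup E]
  [NormedSpace ℂ E] [CStarModule A E]

/-- `T'` is an adjoint of the operator `T` for the `A`-valued inner product. -/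
def IsAdjointOf (T' T : E →L[ℂ] E) : Prop :=
  ∀ x y : E, inner A (T x) y = inner A x (T' y)

/-- The algebra `L(E)` of adjointable operators on the Hilbert module `E`. -/
def adjointableOperators : Subalgebra ℂ (E →L[ℂ] E) where
  carrier := {T | ∃ T', IsAdjointOf A E T' T}
  mul_mem' := by
    rintro T R ⟨T', hT⟩ ⟨R', hR⟩
    exact ⟨R' * T', fun x y => (hT _ _).trans (hR _ _)⟩
  add_mem' := by
    rintro T R ⟨T', hT⟩ ⟨R', hR⟩
    refine ⟨T' + R', fun x y => ?_⟩
    simp [hT x y, hR x y]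
  algebraMap_mem' := by
    intro z
    refine ⟨algebraMap ℂ _ (star z), fun x y => ?_⟩
    simp [Algebra.algebraMap_eq_smul_one]

/-- An adjointable operator `T` is a partial isometry if `T T* T = T`. -/
def IsPartialIsometryOp (T : adjointableOperators A E) : Prop :=
  ∃ T' : adjointableOperators A E, IsAdjointOf A E T'.1 T.1 ∧ T * T' * T = T

end Adjointable

/-! Instead of prescribing `λ(v)` on columns and then checking that linear relations among them are
respected, one acts on all functions `S → D` by the formula an adjoint must satisfy, `(T_v u)(t) =
star σ(v†, t) · u(q(v†) t)`. This is visibly well defined and `D`-linear. Two identities for `σ` do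
the rest. The cocycle rule `σ(ab, t) = σ(a, q(b)t) σ(b, t)` (`sigma_mul`) makes `v ↦ T_v`
multiplicative. The exchange rule `sigma_mul_kernelFun` says exactly that `T_v k_s = k_{q(v)s} σ(v,
s)`; so `T_v` preserves the span of the columns, and the reproducing property turns the formula into
`⟨T_v u, w⟩ = ⟨u, T_{v†} w⟩`.

Both rules rest on two facts about `G`: idempotents with the same image under `q` coincide, and
`j(se) = j(s) j(e)` for idempotent `e` (`j_mul_idem`).

Boundedness is formal: `T_{v†} T_v` is a self-adjoint idempotent, so `⟨T_v u, T_v u⟩ ≤ ⟨u, u⟩`, and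
`T_v` extends to the completion as a contraction. The relation `v v† v = v` gives the partial
isometry property.

Uniqueness needs the complex span of the columns to be dense. Every projection of `D` is some `j(e)`
and satisfies `j(e) k_s = k_{se}`, so projections keep the closed complex span invariant; since they
separate the characters, Stone–Weierstrass extends this to all of `D` (`dense_span_k`).

For injectivity, evaluate `T_v k_1` at `q(v)` and at `q(w)`: equal operators force `q(v) ≤ q(w)` and
conversely, after which `v` is recovered from `σ(v, 1)` (`q_le_of_sigma_eq`, `eq_of_sigma_eq`). -/

/-! ### Idempotents, order and meets with `1` in a Boolean inverse monoid. -/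

namespace BooleanInverseMonoid

variable {S : Type u} [BooleanInverseMonoid S]

lemma mul_of_le_of_idem {a e : S} (he : IsIdempotentElem e) (h : e ≤ a) : a * e = e := by
  obtain ⟨f, hf, hef⟩ := (le_iff_natLE _ _).1 h
  have h1 : e * f = e := by rw [hef, mul_assoc, hf.eq]
  calc a * e = a * (f * e) := by rw [← idem_comm he hf, h1]
    _ = e * e := by rw [← mul_assoc, ← hef]
    _ = e := he.eq

lemma mul_of_idem_le {a b e : S} (he : IsIdempotentElem e) (h : b ≤ e * a) : e * b = b := by
  obtain ⟨f, hf, rfl⟩ := (le_iff_natLE _ _).1 h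
  rw [← mul_assoc, ← mul_assoc, he.eq]

lemma mul_idem_le_of_le_dag_mul {a t e : S} (he : IsIdempotentElem e) (h : e ≤ dag a * t) :
    a * e ≤ t * e := by
  calc a * e = a * (dag a * t * e) := by rw [mul_of_le_of_idem he h]
    _ = (a * dag a) * (t * e) := by simp only [mul_assoc]
    _ ≤ 1 * (t * e) := mul_le_mul_of_le (le_one_of_idem (isIdem_mul_dag a)) le_rfl
    _ = t * e := one_mul _

/-- Two elements agree on every idempotent below `a† t`. -/
lemma mul_eq_mul_of_le_dag_mul {a t e : S} (he : IsIdempotentElem e) (h : e ≤ dag a * t) :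
    a * e = t * e := by
  refine le_antisymm (mul_idem_le_of_le_dag_mul he h) (mul_idem_le_of_le_dag_mul he ?_)
  have h2 := natLE_dag ((le_iff_natLE _ _).1 h)
  rw [dag_idem he, dag_mul, dag_dag] at h2
  exact (le_iff_natLE _ _).2 h2

/-- Anything below `e a` is fixed by left multiplication by `e`, so the factor can be reinserted
after the meet. This is what lets `j(e)` be absorbed into an index of the kernel. -/
lemma idem_mul_inf_one {e : S} (he : IsIdempotentElem e) (a : S) :
    e * a ⊓ 1 = e * (a ⊓ 1) := by
  refine le_antisymm ?_ (le_inf (mul_le_mul_of_le le_rfl inf_le_left) ?_)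
  · have h1 : e * (e * a ⊓ 1) = e * a ⊓ 1 := mul_of_idem_le he inf_le_left
    rw [← h1]
    refine mul_le_mul_of_le le_rfl (le_inf (inf_le_left.trans ?_) inf_le_right)
    calc e * a ≤ 1 * a := mul_le_mul_of_le (le_one_of_idem he) le_rfl
      _ = a := one_mul a
  · calc e * (a ⊓ 1) ≤ 1 * 1 := mul_le_mul_of_le (le_one_of_idem he) inf_le_right
      _ = 1 := one_mul 1

end BooleanInverseMonoid

/-! ### Transferring identities between `G` and the algebra of coefficients. -/

lemma InverseSemigroup.conj_dag_idem {G : Type*} [InverseSemigroup G] (a b : G) :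
    IsIdempotentElem (a * (b * dag b) * dag a) := by
  have := isIdem_mul_dag (a * b)
  rwa [dag_mul, show a * b * (dag b * dag a) = a * (b * dag b) * dag a by
    simp only [mul_assoc]] at this

lemma star_mem_partialIsometries {A : Type*} [CommSemiring A] [StarRing A] {p : A}
    (hp : p ∈ partialIsometries A) : star p ∈ partialIsometries A := by
  change p * star p * p = p at hp
  have := congrArg star hp
  rw [star_mul, star_mul] at this
  change star p * star (star p) * star p = star p
  rwa [mul_assoc]

namespace InvExtension

variable {A : Type*} [CommSemiring A] [StarRing A] {G S : Type*} [InverseSemigroup G]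
  [InverseSemigroup S] (X : InvExtension (partialIsometries A) G S)

lemma pull_eq_of_ι_eq {p : partialIsometries A} {g : G} (hg : IsIdempotentElem (X.q g))
    (h : X.ι p = g) : X.pull g hg = p :=
  X.ι_injective (by rw [X.ι_pull, h])

/-- In a commutative algebra `star p` is a generalized inverse of the partial isometry `p`, and
inverses in `G` are unique. Together with `pull_mul` this reduces identities in `D` to computations
in `G`. -/
lemma ι_star (p : partialIsometries A) :
    X.ι ⟨star p.1, star_mem_partialIsometries p.2⟩ = dag (X.ι p) := by
  have hp : p.1 * star p.1 * p.1 = p.1 := p.2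
  refine dag_unique _ _ ?_ ?_
  · rw [← map_mul, ← map_mul]
    exact congrArg X.ι (Subtype.ext hp)
  · rw [← map_mul, ← map_mul]
    refine congrArg X.ι (Subtype.ext ?_)
    have := star_mem_partialIsometries p.2
    change star p.1 * star (star p.1) * star p.1 = _ at this
    rwa [star_star] at this

lemma isIdem_q_mul {g h : G} (hg : IsIdempotentElem (X.q g)) (hh : IsIdempotentElem (X.q h)) :
    IsIdempotentElem (X.q (g * h)) := by
  rw [map_mul]
  exact isIdem_mul hg hh

lemma isIdem_q_dag {g : G} (hg : IsIdempotentElem (X.q g)) : IsIdempotentElem (X.q (dag g)) := by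
  rwa [X.q_dag, dag_idem hg]

lemma pull_mul {g h : G} (hg : IsIdempotentElem (X.q g)) (hh : IsIdempotentElem (X.q h)) :
    (X.pull g hg).1 * (X.pull h hh).1 = (X.pull (g * h) (X.isIdem_q_mul hg hh)).1 :=
  congrArg Subtype.val (X.pull_eq_of_ι_eq (p := X.pull g hg * X.pull h hh) _
    (by rw [map_mul, X.ι_pull, X.ι_pull])).symm

lemma star_pull {g : G} (hg : IsIdempotentElem (X.q g)) :
    star (X.pull g hg).1 = (X.pull (dag g) (X.isIdem_q_dag hg)).1 :=
  congrArg Subtype.val (X.pull_eq_of_ι_eq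
    (p := ⟨star (X.pull g hg).1, star_mem_partialIsometries (X.pull g hg).2⟩) _
    (by rw [X.ι_star, X.ι_pull])).symm

lemma pull_congr {g h : G} (hg : IsIdempotentElem (X.q g)) (hh : IsIdempotentElem (X.q h))
    (e : g = h) : (X.pull g hg).1 = (X.pull h hh).1 := by
  subst e
  rfl

lemma eq_of_pull_eq {g h : G} (hg : IsIdempotentElem (X.q g)) (hh : IsIdempotentElem (X.q h))
    (e : (X.pull g hg).1 = (X.pull h hh).1) : g = h := by
  rw [← X.ι_pull g hg, ← X.ι_pull h hh, Subtype.ext e]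

end InvExtension

/-! ### The cocycle `σ` and its relation to the kernel. -/

namespace OrderPreservingSection

variable {S : Type u} [BooleanInverseMonoid S] {G : Type v} [InverseSemigroup G]
  {X : BooleanExtension S G} (J : OrderPreservingSection X)

open BooleanInverseMonoid

/-- Although `j` is not multiplicative, monotonicity gives `j(se) = j(s) f` for some idempotent `f`.
The source idempotent of `j(se)` is `j(s)†j(s) f` on one hand and, by separation of idempotents,
`j(s)†j(s) j(e)` on the other; multiplying by `j(s)` replaces `f` by `j(e)`. -/
lemma j_mul_idem (s : S) {e : S} (he : IsIdempotentElem e) : J.j (s * e) = J.j s * J.j e := by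
  obtain ⟨f, hf, h⟩ := J.j_mono (s * e) s ((le_iff_natLE _ _).2 ⟨e, he, rfl⟩)
  have h1 : dag (J.j (s * e)) * J.j (s * e) = dag (J.j s) * J.j s * J.j e := by
    refine idem_sep (X := X) (isIdem_dag_mul _)
      (isIdem_mul (isIdem_dag_mul _) (J.isIdem_j he)) ?_
    simp only [map_mul, X.q_dag, J.q_j]
    rw [dag_mul, dag_idem he, mul_assoc e, ← mul_assoc (dag s),
      ← mul_assoc e, idem_comm he (isIdem_dag_mul s), mul_assoc, he.eq]
  have h2 : dag (J.j (s * e)) * J.j (s * e) = dag (J.j s) * J.j s * f := by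
    rw [h, dag_mul, dag_idem hf, mul_assoc f, ← mul_assoc (dag (J.j s)),
      ← mul_assoc f, idem_comm hf (isIdem_dag_mul _), mul_assoc, hf.eq]
  calc J.j (s * e) = J.j s * (dag (J.j s) * J.j s * f) := by
        rw [h, ← mul_assoc, ← mul_assoc, mul_dag_mul]
    _ = J.j s * J.j e := by
        rw [← h2, h1, ← mul_assoc, ← mul_assoc, mul_dag_mul]

lemma isIdem_q_sigma (v : G) (s : S) :
    IsIdempotentElem (X.q (dag (J.j (X.q v * s)) * v * J.j s)) := by
  rw [map_mul, map_mul, X.q_dag, J.q_j, J.q_j, mul_assoc]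
  exact isIdem_dag_mul _

lemma isIdem_q_j {e : S} (he : IsIdempotentElem e) : IsIdempotentElem (X.q (J.j e)) := by
  rwa [J.q_j]

/-- The range idempotents of `j(q(b)t)` and of `b j(t)` have the same image in `S`, hence coincide.
So `j(q(b)t) j(q(b)t)†` can be inserted before `b j(t)` without changing it, and it splits the
product into the two values of `σ`. -/
lemma sigma_mul (a b : G) (t : S) :
    J.sigma (a * b) t = J.sigma a (X.q b * t) * J.sigma b t := by
  refine Eq.trans ?_ (X.pull_mul (J.isIdem_q_sigma _ _) (J.isIdem_q_sigma _ _)).symm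
  refine X.pull_congr _ _ ?_
  have h : J.j (X.q b * t) * dag (J.j (X.q b * t)) = b * (J.j t * dag (J.j t)) * dag b :=
    idem_sep (X := X) (isIdem_mul_dag _) (conj_dag_idem _ _) (by
      simp only [map_mul, X.q_dag, J.q_j, dag_mul, mul_assoc])
  have h2 : b * (J.j t * dag (J.j t)) * dag b * (b * J.j t) = b * J.j t := by
    have := mul_dag_mul (b * J.j t)
    rwa [dag_mul, show b * J.j t * (dag (J.j t) * dag b) * (b * J.j t) =
      b * (J.j t * dag (J.j t)) * dag b * (b * J.j t) by simp only [mul_assoc]] at this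
  calc dag (J.j (X.q (a * b) * t)) * (a * b) * J.j t
      = dag (J.j (X.q a * (X.q b * t))) * a * (b * J.j t) := by
        simp only [map_mul, mul_assoc]
    _ = dag (J.j (X.q a * (X.q b * t))) * a *
        (J.j (X.q b * t) * dag (J.j (X.q b * t)) * (b * J.j t)) := by rw [h, h2]
    _ = _ := by simp only [mul_assoc]

/-- The identity that makes the operators of `v` and `v†` adjoint to each other. -/
lemma sigma_mul_kernelFun (v : G) (s t : S) :
    J.sigma v s * J.kernelFun t (X.q v * s) =
      star (J.sigma (dag v) t) * J.kernelFun (X.q (dag v) * t) s := by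
  -- Both kernel values are `j(e)` for this one `e`. On `e` the element `q(v)s` agrees with `t`, and
  -- `s` agrees with `q(v†)t`.
  obtain ⟨e, hee⟩ : ∃ e, e = dag (X.q v * s) * t ⊓ 1 := ⟨_, rfl⟩
  have he : IsIdempotentElem e := by rw [hee]; exact isIdem_of_le_one inf_le_right
  have hd : dag (X.q v * s) * t = dag s * (X.q (dag v) * t) := by
    rw [dag_mul, X.q_dag, mul_assoc]
  have hl : J.kernelFun t (X.q v * s) = (X.pull (J.j e) (J.isIdem_q_j he)).1 :=
    X.pull_congr _ _ (by rw [hee])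
  have hr : J.kernelFun (X.q (dag v) * t) s = (X.pull (J.j e) (J.isIdem_q_j he)).1 :=
    X.pull_congr _ _ (by rw [hee, hd])
  have hm : X.q v * s * e = t * e :=
    mul_eq_mul_of_le_dag_mul he (by rw [hee]; exact inf_le_left)
  have hn : s * e = X.q (dag v) * t * e :=
    mul_eq_mul_of_le_dag_mul he (by rw [hee, hd]; exact inf_le_left)
  have hje := J.isIdem_j he
  have hp : (X.pull (J.j e) (J.isIdem_q_j he)).1 * (X.pull (J.j e) (J.isIdem_q_j he)).1 =
      (X.pull (J.j e) (J.isIdem_q_j he)).1 := by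
    rw [X.pull_mul]
    exact X.pull_congr _ _ hje.eq
  -- Commutativity of `D` allows a compression by `j(e)` on both sides, so that each occurrence of
  -- `j` inside `σ` meets a factor `j(e)`.
  have key : ∀ d : DAlg S, d * (X.pull (J.j e) (J.isIdem_q_j he)).1 =
      (X.pull (J.j e) (J.isIdem_q_j he)).1 * d * (X.pull (J.j e) (J.isIdem_q_j he)).1 :=
    fun d => by rw [mul_comm _ d, mul_assoc, hp]
  rw [hl, hr, key, key (star _)]
  unfold sigma
  rw [X.star_pull, X.pull_mul, X.pull_mul, X.pull_mul, X.pull_mul]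
  refine X.pull_congr _ _ ?_
  calc J.j e * (dag (J.j (X.q v * s)) * v * J.j s) * J.j e
      = dag (J.j (X.q v * s) * J.j e) * v * (J.j s * J.j e) := by
        rw [dag_mul, dag_idem hje]
        simp only [mul_assoc]
    _ = dag (J.j t * J.j e) * v * (J.j (X.q (dag v) * t) * J.j e) := by
        rw [← J.j_mul_idem _ he, ← J.j_mul_idem _ he, ← J.j_mul_idem _ he, ← J.j_mul_idem _ he,
          hm, hn]
    _ = _ := by
        simp only [dag_mul, dag_idem hje, dag_dag, mul_assoc]

/-- With `a = q(v)` and `b = q(w)`, applying `q` to the hypothesis leaves `a†a = b†b (b†a ∧ 1)`,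
whence `a†a ≤ b†a`. Thus `a` and `b` agree on the source of `a`. -/
lemma q_le_of_sigma_eq {v w : G}
    (h : J.sigma v 1 * J.kernelFun (X.q v) (X.q v * 1) =
      J.sigma w 1 * J.kernelFun (X.q v) (X.q w * 1)) :
    X.q v ≤ X.q w := by
  unfold sigma kernelFun proj at h
  rw [X.pull_mul, X.pull_mul] at h
  have h1 := congrArg X.q (X.eq_of_pull_eq _ _ h)
  simp only [map_mul, X.q_dag, J.q_j, mul_one] at h1
  obtain ⟨a, ha⟩ : ∃ a, a = X.q v := ⟨_, rfl⟩
  obtain ⟨b, hb⟩ : ∃ b, b = X.q w := ⟨_, rfl⟩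
  rw [← ha, ← hb] at h1 ⊢
  have hi := isIdem_dag_mul a
  have h2 : dag a * a ⊓ 1 = dag a * a := inf_eq_left.2 (le_one_of_idem hi)
  rw [h2, hi.eq] at h1
  have hle : dag a * a ≤ dag b * a := by
    rw [h1]
    calc dag b * b * (dag b * a ⊓ 1) ≤ 1 * (dag b * a) :=
          mul_le_mul_of_le (le_one_of_idem (isIdem_dag_mul b)) inf_le_left
      _ = dag b * a := one_mul _
  have h3 := mul_eq_mul_of_le_dag_mul hi hle
  refine (le_iff_natLE _ _).2 ⟨dag a * a, hi, ?_⟩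
  rw [h3, ← mul_assoc, mul_dag_mul]

/-- An element `v` of the extension is determined by `q(v)` and the function `k_{q(v)} σ(v, 1)`. -/
lemma eq_of_sigma_eq {v w : G} (hq : X.q v = X.q w)
    (h : J.sigma v 1 * J.kernelFun (X.q v) (X.q v * 1) =
      J.sigma w 1 * J.kernelFun (X.q v) (X.q w * 1)) : v = w := by
  unfold sigma kernelFun proj at h
  rw [X.pull_mul, X.pull_mul] at h
  have h1 := X.eq_of_pull_eq _ _ h
  have hi : IsIdempotentElem (dag (X.q w) * X.q w) := isIdem_dag_mul _
  have h2 : dag (X.q w) * X.q w ⊓ 1 = dag (X.q w) * X.q w := inf_eq_left.2 (le_one_of_idem hi)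
  simp only [hq, mul_one, h2, (J.j_one _).2] at h1
  -- The outer factors are determined by their images in `S`: they are `x x†` and `x† x`, so the
  -- product collapses to `x`.
  have key : ∀ x : G, X.q x = X.q w → J.j (X.q w) * (dag (J.j (X.q w)) * x *
      J.j (dag (X.q w) * X.q w)) = x := by
    intro x hx
    have e1 : J.j (X.q w) * dag (J.j (X.q w)) = x * dag x :=
      idem_sep (X := X) (isIdem_mul_dag _) (isIdem_mul_dag _)
        (by rw [map_mul, map_mul, X.q_dag, X.q_dag, J.q_j, hx])
    have e2 : J.j (dag (X.q w) * X.q w) = dag x * x :=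
      idem_sep (X := X) (J.isIdem_j hi) (isIdem_dag_mul _)
        (by rw [map_mul, X.q_dag, J.q_j, hx])
    rw [← mul_assoc, ← mul_assoc, e1, e2, mul_dag_mul, ← mul_assoc, mul_dag_mul]
  rw [← key v hq, h1, key w rfl]

end OrderPreservingSection

/-! ### A density criterion for the complex span of the columns. -/

namespace PositiveKernel

variable {S : Type u} {X : Type v} [TopologicalSpace X] [CompactSpace X] {κ : PositiveKernel S X}

lemma eval_smul (h : C(X, ℂ)) (u : κ.RKModule) (s : S) :
    κ.eval (h • u) s = h * κ.eval u s :=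
  CStarModule.inner_op_smul_right

lemma eval_smulc (z : ℂ) (u : κ.RKModule) (s : S) : κ.eval (z • u) s = z • κ.eval u s :=
  CStarModule.inner_smul_right_complex

lemma eval_k (s t : S) : κ.eval (κ.k s) t = κ.K t s := κ.inner_k_k t s

lemma algebraMap_smul_rk (z : ℂ) (u : κ.RKModule) : algebraMap ℂ C(X, ℂ) z • u = z • u := by
  refine κ.eval_injective (funext fun s => ?_)
  rw [eval_smul, eval_smulc, Algebra.smul_def]

instance : SMulCommClass C(X, ℂ) ℂ κ.RKModule where
  smul_comm h z u := by
    rw [← algebraMap_smul_rk, ← algebraMap_smul_rk, smul_smul, smul_smul, mul_comm]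

/-- The orbit of a column stays in the pre-module, where the action is bounded. -/
lemma continuous_smul_k (s : S) : Continuous fun h : C(X, ℂ) => h • κ.k s := by
  have : (fun h : C(X, ℂ) => h • κ.k s) = fun h => toRK (h • κ.preCol s) :=
    funext fun h => toRK_smul h _
  rw [this]
  exact (UniformSpace.Completion.continuous_coe _).comp
    (continuous_id.smul continuous_const)

variable (κ)

/-- The coefficients which together with their adjoints leave the closed complex span of the
columns invariant. -/
noncomputable def spanMultipliers : StarSubalgebra ℂ C(X, ℂ) where
  carrier := {h | ∀ u ∈ (Submodule.span ℂ (Set.range κ.k)).topologicalClosure,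
    h • u ∈ (Submodule.span ℂ (Set.range κ.k)).topologicalClosure ∧
    star h • u ∈ (Submodule.span ℂ (Set.range κ.k)).topologicalClosure}
  mul_mem' := by
    intro a b ha hb u hu
    rw [mul_smul, star_mul, mul_smul]
    exact ⟨(ha _ (hb u hu).1).1, (hb _ (ha u hu).2).2⟩
  add_mem' := by
    intro a b ha hb u hu
    rw [add_smul, star_add, add_smul]
    exact ⟨add_mem (ha u hu).1 (hb u hu).1, add_mem (ha u hu).2 (hb u hu).2⟩
  algebraMap_mem' := by
    intro z u hu
    rw [← algebraMap_star_comm, algebraMap_smul_rk, algebraMap_smul_rk]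
    exact ⟨Submodule.smul_mem _ _ hu, Submodule.smul_mem _ _ hu⟩
  star_mem' := by
    intro a ha u hu
    rw [star_star]
    exact (ha u hu).symm

variable {κ}

/-- Multiplication by `h` is continuous and commutes with complex scalars, so invariance need only
be tested on columns. -/
lemma smul_mem_closure_span {h : C(X, ℂ)}
    (hk : ∀ s, h • κ.k s ∈ (Submodule.span ℂ (Set.range κ.k)).topologicalClosure)
    {u : κ.RKModule} (hu : u ∈ (Submodule.span ℂ (Set.range κ.k)).topologicalClosure) :
    h • u ∈ (Submodule.span ℂ (Set.range κ.k)).topologicalClosure := by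
  have hc : IsClosed ((fun u : κ.RKModule => h • u) ⁻¹'
      ((Submodule.span ℂ (Set.range κ.k)).topologicalClosure : Set κ.RKModule)) :=
    (Submodule.isClosed_topologicalClosure _).preimage (continuous_const_smul h)
  refine closure_minimal (fun w hw => ?_) hc hu
  change h • w ∈ (Submodule.span ℂ (Set.range κ.k)).topologicalClosure
  induction hw using Submodule.span_induction with
  | mem w hw => obtain ⟨s, rfl⟩ := hw; exact hk s
  | zero => rw [smul_zero]; exact zero_mem _
  | add a b _ _ ha hb => rw [smul_add]; exact add_mem ha hb
  | smul z a _ ha => rw [smul_comm]; exact Submodule.smul_mem _ _ ha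

/-- By Stone–Weierstrass the multipliers are dense in `C(X)`. Continuity of `h ↦ h • k_s` then puts
every `h • k_s` in the closed complex span, which therefore contains the dense pre-module. -/
lemma dense_span_k_of_separatesPoints (hsep : κ.spanMultipliers.SeparatesPoints) :
    Dense (Submodule.span ℂ (Set.range κ.k) : Set κ.RKModule) := by
  have htop :=
    ContinuousMap.starSubalgebra_topologicalClosure_eq_top_of_separatesPoints _ hsep
  have hk : ∀ (h : C(X, ℂ)) (s : S),
      h • κ.k s ∈ (Submodule.span ℂ (Set.range κ.k)).topologicalClosure := by
    intro h s
    have hmem : h ∈ closure (κ.spanMultipliers : Set C(X, ℂ)) := by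
      rw [← StarSubalgebra.topologicalClosure_coe, htop]
      trivial
    have hc : IsClosed ((fun h : C(X, ℂ) => h • κ.k s) ⁻¹'
        ((Submodule.span ℂ (Set.range κ.k)).topologicalClosure : Set κ.RKModule)) :=
      (Submodule.isClosed_topologicalClosure _).preimage (continuous_smul_k s)
    refine closure_minimal (fun a ha => ?_) hc hmem
    exact (ha _ (Submodule.le_topologicalClosure _ (Submodule.subset_span ⟨s, rfl⟩))).1
  have hpre : ∀ u : κ.Pre, toRK u ∈ (Submodule.span ℂ (Set.range κ.k)).topologicalClosure := by
    intro u
    induction u using Pre.induction with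
    | zero => exact zero_mem _
    | col s => exact Submodule.le_topologicalClosure _ (Submodule.subset_span ⟨s, rfl⟩)
    | add a b ha hb => rw [← toRK_add]; exact add_mem ha hb
    | smul h a ha => rw [← toRK_smul]; exact smul_mem_closure_span (hk h) ha
  exact dense_closure.1 (denseRange_toRK.mono (by rintro _ ⟨u, rfl⟩; exact hpre u))

end PositiveKernel

/-! ### Indicator functions separate the characters. -/

namespace CharacterSpace

variable {L : Type u} [BooleanAlgebra L]

/-- The indicator function of the clopen set of the characters supported on `e`. -/
noncomputable def indicator (e : L) : C(CharacterSpace L, ℂ) where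
  toFun x := bif x.hom e then 1 else 0
  continuous_toFun :=
    (continuous_of_discreteTopology (f := fun b : Bool => (bif b then 1 else 0 : ℂ))).comp
      ((continuous_apply (A := fun _ : L => Bool) e).comp isInducing_hom.continuous)

lemma indicator_mul_self (e : L) : indicator e * indicator e = indicator e := by
  ext x
  change (bif x.hom e then 1 else 0 : ℂ) * (bif x.hom e then 1 else 0) = bif x.hom e then 1 else 0
  cases x.hom e <;> simp

lemma star_indicator (e : L) : star (indicator e) = indicator e := by
  ext x
  change star (bif x.hom e then 1 else 0 : ℂ) = bif x.hom e then 1 else 0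
  cases x.hom e <;> simp

lemma exists_indicator_ne {x y : CharacterSpace L} (h : x ≠ y) :
    ∃ e : L, indicator e x ≠ indicator e y := by
  by_contra! hc
  refine h (congrArg CharacterSpace.mk (DFunLike.ext _ _ fun e => ?_) : mk x.hom = mk y.hom)
  have he : (bif x.hom e then 1 else 0 : ℂ) = bif y.hom e then 1 else 0 := hc e
  cases h1 : x.hom e <;> cases h2 : y.hom e <;> simp_all

end CharacterSpace

/-! ### Density of the complex span of the columns. -/

namespace OrderPreservingSection

variable {S : Type u} [BooleanInverseMonoid S] {G : Type v} [InverseSemigroup G]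
  {X : BooleanExtension S G} (J : OrderPreservingSection X)

open BooleanInverseMonoid

/-- A projection `d` is an idempotent of `P`. Take `e` to be its image in `S`; then `ι(d)` and
`j(e)` are idempotents over the same `e`, hence equal. -/
lemma exists_proj_eq {d : DAlg S} (hd : d * d = d) (hs : star d = d) :
    ∃ (e : S) (he : IsIdempotentElem e), J.proj e he = d := by
  have hp : d ∈ partialIsometries (DAlg S) := by
    change d * star d * d = d
    rw [hs, hd, hd]
  have hi : IsIdempotentElem (⟨d, hp⟩ : partialIsometries (DAlg S)) := Subtype.ext hd
  have hg : IsIdempotentElem (X.ι ⟨d, hp⟩) := hi.map X.ι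
  have he : IsIdempotentElem (X.q (X.ι ⟨d, hp⟩)) := hg.map X.q
  refine ⟨_, he, congrArg Subtype.val (X.pull_eq_of_ι_eq (p := ⟨d, hp⟩) _ ?_)⟩
  exact idem_sep (X := X) hg (J.isIdem_j he) (by rw [J.q_j])

lemma proj_mul_kernelFun {e : S} (he : IsIdempotentElem e) (t s : S) :
    J.proj e he * J.kernelFun t s = J.kernelFun t (s * e) := by
  have hi : IsIdempotentElem (dag s * t ⊓ 1) := isIdem_of_le_one inf_le_right
  refine (J.proj_mul he hi (isIdem_mul he hi)).symm.trans ?_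
  refine X.pull_congr _ _ (congrArg J.j ?_)
  rw [dag_mul, dag_idem he, mul_assoc, idem_mul_inf_one he]

/-- Projections of `D` act on columns by shifting the index, so they never leave the complex span.
-/
lemma proj_smul_k {e : S} (he : IsIdempotentElem e) (s : S) :
    J.proj e he • J.kernel.k s = J.kernel.k (s * e) := by
  refine J.kernel.eval_injective (funext fun t => ?_)
  rw [PositiveKernel.eval_smul, PositiveKernel.eval_k, PositiveKernel.eval_k]
  exact J.proj_mul_kernelFun he t s

lemma dense_span_k :
    Dense (Submodule.span ℂ (Set.range J.kernel.k) : Set J.hilbertModule) := by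
  refine PositiveKernel.dense_span_k_of_separatesPoints fun x y hxy => ?_
  obtain ⟨e, he⟩ := CharacterSpace.exists_indicator_ne hxy
  refine ⟨_, ⟨CharacterSpace.indicator e, ?_, rfl⟩, he⟩
  have key : ∀ u ∈ (Submodule.span ℂ (Set.range J.kernel.k)).topologicalClosure,
      CharacterSpace.indicator e • u ∈
        (Submodule.span ℂ (Set.range J.kernel.k)).topologicalClosure := by
    intro u hu
    refine PositiveKernel.smul_mem_closure_span (fun s => ?_) hu
    obtain ⟨f, hf, hfe⟩ := J.exists_proj_eq (CharacterSpace.indicator_mul_self e)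
      (CharacterSpace.star_indicator e)
    rw [← hfe, J.proj_smul_k hf]
    exact Submodule.le_topologicalClosure _ (Submodule.subset_span ⟨_, rfl⟩)
  intro u hu
  rw [CharacterSpace.star_indicator]
  exact ⟨key u hu, key u hu⟩

end OrderPreservingSection

/-! ### The operators, their extension to the completion, and faithfulness. -/

namespace OrderPreservingSection

variable {S : Type u} [BooleanInverseMonoid S] {G : Type v} [InverseSemigroup G]
  {X : BooleanExtension S G} (J : OrderPreservingSection X)

open BooleanInverseMonoid PositiveKernel

/-- The operator of `v` on functions, `(T u)(t) = (star σ(v†, t)) u(q(v†) t)`. -/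
noncomputable def funOp (v : G) : (S → DAlg S) →ₗ[DAlg S] (S → DAlg S) where
  toFun u t := star (J.sigma (dag v) t) * u (X.q (dag v) * t)
  map_add' u w := by
    ext1 t
    exact mul_add _ _ _
  map_smul' h u := by
    ext1 t
    exact mul_left_comm _ _ _

lemma funOp_mul (v w : G) : J.funOp (v * w) = J.funOp v ∘ₗ J.funOp w := by
  refine LinearMap.ext fun u => funext fun t => ?_
  change star (J.sigma (dag (v * w)) t) * u (X.q (dag (v * w)) * t) =
    star (J.sigma (dag v) t) * (star (J.sigma (dag w) (X.q (dag v) * t)) *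
      u (X.q (dag w) * (X.q (dag v) * t)))
  -- Since `(vw)† = w† v†`, the cocycle rule is used with `a = w†` and `b = v†`.
  rw [dag_mul, J.sigma_mul, star_mul, map_mul, mul_assoc, mul_assoc]

lemma funOp_col (v : G) (s : S) :
    J.funOp v (J.kernel.col s) = J.sigma v s • J.kernel.col (X.q v * s) :=
  funext fun t => (J.sigma_mul_kernelFun v s t).symm

lemma funOp_mem (v : G) {u : S → DAlg S}
    (hu : u ∈ Submodule.span (DAlg S) (Set.range J.kernel.col)) :
    J.funOp v u ∈ Submodule.span (DAlg S) (Set.range J.kernel.col) := by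
  refine (Submodule.map_span_le (J.funOp v) _ _).2 ?_ (Submodule.mem_map_of_mem hu)
  rintro _ ⟨s, rfl⟩
  rw [J.funOp_col]
  exact Submodule.smul_mem _ _ (Submodule.subset_span ⟨_, rfl⟩)

/-- The operator of `v` on the span of the columns. -/
noncomputable def preOp (v : G) : J.kernel.Pre →ₗ[ℂ] J.kernel.Pre where
  toFun u := ⟨J.funOp v u.fn, J.funOp_mem v u.2⟩
  map_add' u w := Subtype.ext (map_add (J.funOp v) u.fn w.fn)
  map_smul' z u := by
    refine Subtype.ext (funext fun t => ?_)
    exact mul_smul_comm z _ _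

lemma fn_preOp_apply (v : G) (u : J.kernel.Pre) (t : S) :
    (J.preOp v u).fn t = star (J.sigma (dag v) t) * u.fn (X.q (dag v) * t) := rfl

lemma preOp_mul_apply (v w : G) (u : J.kernel.Pre) :
    J.preOp (v * w) u = J.preOp v (J.preOp w u) :=
  Subtype.ext (congrArg (fun T => T u.fn) (J.funOp_mul v w))

lemma preOp_preCol (v : G) (s : S) :
    J.preOp v (J.kernel.preCol s) = J.sigma v s • J.kernel.preCol (X.q v * s) :=
  Subtype.ext (J.funOp_col v s)

lemma preOp_smul (v : G) (h : DAlg S) (u : J.kernel.Pre) :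
    J.preOp v (h • u) = h • J.preOp v u :=
  Subtype.ext (map_smul (J.funOp v) h u.fn)

/-- By linearity `u` may be a column `k_s`; then both sides equal `star σ(v, s) · w(q(v)s)`, by the
reproducing property and `v†† = v`. -/
lemma ip_preOp_left (v : G) (u w : J.kernel.Pre) :
    Pre.ip (J.preOp v u) w = Pre.ip u (J.preOp (dag v) w) := by
  have hl : ∀ (h : DAlg S) (a w : J.kernel.Pre), Pre.ip (h • a) w = star h * Pre.ip a w := by
    intro h a w
    rw [← Pre.star_ip, Pre.ip_smul_right, star_mul, Pre.star_ip, mul_comm]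
  have hadd : ∀ a b w : J.kernel.Pre, Pre.ip (a + b) w = Pre.ip a w + Pre.ip b w := by
    intro a b w
    rw [← Pre.star_ip, Pre.ip_add_right, star_add, Pre.star_ip, Pre.star_ip]
  induction u using Pre.induction with
  | zero =>
    have h0 : ∀ w : J.kernel.Pre, Pre.ip 0 w = 0 := fun w => by
      simpa using hl 0 0 w
    rw [map_zero, h0, h0]
  | col s =>
    rw [preOp_preCol, hl, Pre.ip_preCol_left, Pre.ip_preCol_left, fn_preOp_apply, dag_dag]
  | add a b ha hb => rw [map_add, hadd, hadd, ha, hb]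
  | smul h a ha => rw [preOp_smul, hl, hl, ha]

/-- The vector `w = T_{v†} T_v u` is the projection of `u` onto the initial space of `T_v`. The
difference of the two sides is `⟨u - w, u - w⟩`, which is nonnegative. -/
lemma ip_preOp_preOp_le (v : G) (u : J.kernel.Pre) :
    Pre.ip (J.preOp v u) (J.preOp v u) ≤ Pre.ip u u := by
  obtain ⟨w, hw⟩ : ∃ w, w = J.preOp (dag v) (J.preOp v u) := ⟨_, rfl⟩
  have h1 : Pre.ip (J.preOp v u) (J.preOp v u) = Pre.ip u w := by rw [ip_preOp_left, hw]
  have hv : J.preOp v w = J.preOp v u := by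
    rw [hw, ← preOp_mul_apply, ← preOp_mul_apply, mul_dag_mul]
  have h2 : Pre.ip w w = Pre.ip u w :=
    calc Pre.ip w w = Pre.ip (J.preOp (dag v) (J.preOp v u)) w := by rw [← hw]
      _ = Pre.ip u w := by rw [ip_preOp_left, dag_dag, hv, h1]
  -- `⟨u, w⟩` equals `⟨T_v u, T_v u⟩`, which is self-adjoint.
  have h3 : Pre.ip w u = Pre.ip u w := by
    rw [← Pre.star_ip, ← h1, Pre.star_ip]
  have h4 := Pre.ip_self_nonneg (u - w)
  have h5 : Pre.ip (u - w) (u - w) = Pre.ip u u - Pre.ip u w := by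
    change inner (DAlg S) (u - w) (u - w) = _
    rw [CStarModule.inner_sub_left, CStarModule.inner_sub_right, CStarModule.inner_sub_right]
    change Pre.ip u u - Pre.ip u w - (Pre.ip w u - Pre.ip w w) = _
    rw [h2, h3, sub_self, sub_zero]
  rw [h5, ContinuousMap.le_def] at h4
  rw [h1, ContinuousMap.le_def]
  exact fun x => sub_nonneg.1 (h4 x)

lemma norm_preOp_le (v : G) (u : J.kernel.Pre) : ‖J.preOp v u‖ ≤ ‖u‖ := by
  refine Real.sqrt_le_sqrt ?_
  refine (ContinuousMap.norm_le _ (norm_nonneg _)).2 fun x => ?_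
  refine le_trans ?_ (ContinuousMap.norm_coe_le_norm _ x)
  have h0 := ContinuousMap.le_def.1 (Pre.ip_self_nonneg (J.preOp v u)) x
  have h1 := ContinuousMap.le_def.1 (J.ip_preOp_preOp_le v u) x
  exact CStarAlgebra.norm_le_norm_of_nonneg_of_le h0 h1

/-- The operator of `v` on the Hilbert module. -/
noncomputable def op (v : G) : J.hilbertModule →L[ℂ] J.hilbertModule :=
  ((J.preOp v).mkContinuous 1 fun u => by
    rw [one_mul]
    exact J.norm_preOp_le v u).completion

lemma op_toRK (v : G) (u : J.kernel.Pre) : J.op v (toRK u) = toRK (J.preOp v u) :=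
  ContinuousLinearMap.completion_apply_coe _ _

lemma op_k (v : G) (s : S) :
    J.op v (J.kernel.k s) = J.sigma v s • J.kernel.k (X.q v * s) := by
  rw [k, op_toRK, preOp_preCol, k, toRK_smul]

lemma op_mul (v w : G) : J.op (v * w) = J.op v * J.op w := by
  refine ContinuousLinearMap.ext fun u => ?_
  refine denseRange_toRK.induction_on
    (p := fun u : J.hilbertModule => J.op (v * w) u = J.op v (J.op w u)) u ?_ fun u => ?_
  · exact isClosed_eq (J.op (v * w)).continuous ((J.op v).continuous.comp (J.op w).continuous)
  · rw [op_toRK, op_toRK, op_toRK, preOp_mul_apply]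

lemma isAdjointOf_op (v : G) : IsAdjointOf (DAlg S) J.hilbertModule (J.op (dag v)) (J.op v) := by
  intro u w
  refine denseRange_toRK.induction_on₂ (p := fun u w : J.hilbertModule =>
    inner (DAlg S) (J.op v u) w = inner (DAlg S) u (J.op (dag v) w)) ?_ ?_ u w
  · exact isClosed_eq
      (continuous_inner_rk.comp (((J.op v).continuous.comp continuous_fst).prodMk continuous_snd))
      (continuous_inner_rk.comp
        (continuous_fst.prodMk ((J.op (dag v)).continuous.comp continuous_snd)))
  · intro u w
    rw [op_toRK, op_toRK, inner_toRK, inner_toRK, ip_preOp_left]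

/-- The representation of the extension by adjointable operators. -/
noncomputable def rep : G →ₙ* adjointableOperators (DAlg S) J.hilbertModule where
  toFun v := ⟨J.op v, J.op (dag v), J.isAdjointOf_op v⟩
  map_mul' v w := Subtype.ext (J.op_mul v w)

lemma sigma_mul_kernelFun_eq_of_op_eq {v w : G} (h : J.op v = J.op w) (s t : S) :
    J.sigma v s * J.kernelFun t (X.q v * s) = J.sigma w s * J.kernelFun t (X.q w * s) := by
  have h1 := congrArg (fun T => J.kernel.eval (T (J.kernel.k s)) t) h
  simp only [op_k, eval_smul, eval_k] at h1
  exact h1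

lemma op_injective : Function.Injective J.op := by
  intro v w h
  -- The image of `k_1` is compared at `q(v)` and at `q(w)`, one evaluation for each inequality; the
  -- first is then reused to recover `v`.
  have h1 := J.sigma_mul_kernelFun_eq_of_op_eq h 1 (X.q v)
  have h2 := J.sigma_mul_kernelFun_eq_of_op_eq h.symm 1 (X.q w)
  exact J.eq_of_sigma_eq (le_antisymm (J.q_le_of_sigma_eq h1) (J.q_le_of_sigma_eq h2)) h1

end OrderPreservingSection

theorem theorem4p11 {S : Type u} [BooleanInverseMonoid S] {G : Type v} [InverseSemigroup G]
    (X : BooleanExtension S G) (J : OrderPreservingSection X) :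
    Dense (Submodule.span ℂ (Set.range J.kernel.k) : Set J.hilbertModule) ∧
    ∃ lam : G →ₙ* adjointableOperators (DAlg S) J.hilbertModule,
      (∀ (v : G) (s : S),
        (lam v).1 (J.kernel.k s) = J.sigma v s • J.kernel.k (X.q v * s)) ∧
      (∀ (v : G) (T : J.hilbertModule →L[ℂ] J.hilbertModule),
        (∀ s : S, T (J.kernel.k s) = J.sigma v s • J.kernel.k (X.q v * s)) → T = (lam v).1) ∧
      (∀ v : G, IsPartialIsometryOp (DAlg S) J.hilbertModule (lam v)) ∧
      (∀ v : G, IsAdjointOf (DAlg S) J.hilbertModule (lam (dag v)).1 (lam v).1) ∧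
      Function.Injective lam := by
  refine ⟨J.dense_span_k, J.rep, J.op_k, fun v T hT => ?_,
    fun v => ⟨J.rep (dag v), J.isAdjointOf_op v, ?_⟩, J.isAdjointOf_op,
    fun v w h => J.op_injective (congrArg Subtype.val h)⟩
  · refine ContinuousLinearMap.ext_on J.dense_span_k ?_
    rintro _ ⟨s, rfl⟩
    exact (hT s).trans (J.op_k v s).symm
  · rw [← map_mul, ← map_mul, mul_dag_mul]
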